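/- **Setting.** All logarithms are base 2. A vendor holds a database $d=(d_0,\dots,d_{k-1})$ of $k\ge 1$ items of $m\ge 1$ bits each, uniformly distributed on $(\{0,1\}^m)^k$; put $\ell=2^m$. Let $A_0,\dots,A_{k-1}$ be $\ell\times\ell$ unitary matrices (or real orthogonal matrices). For $0\le i<k$ let $$C_i=A_i\otimes A_{i+1}\otimes\cdots\otimes A_{k-1}\otimes A_0\otimes\cdots\otimes A_{i-1},\qquad E_i=C_iP_i,$$ where $P_i$ is the permutation matrix that reorders $d_0d_1\cdots d_{k-1}$ to $d_id_{i+1}\cdots d_{k-1}d_0\cdots d_{i-1}$. The vendor picks an encoding $i$ and sends the state $E_i d$, i.e. column $d$ of $E_i$. An honest user who chooses item $j$ applies $M_j=A_j^\dagger\otimes\cdots\otimes A_j^\dagger$ and observes the outcome $y$ with probability $P(y\mid d,i)=|(M_jE_i)_{y,d}|^2$; afterwards $i$ is announced to the user, who forms by Bayes' theorem the posterior distribution $P(d\mid y,i)$. The information that the user has learned about the other items is the reduction of Shannon entropy $$I_{j,i,y}=H\big((d_s)_{s\ne j}\big)-H\big((d_s)_{s\ne j}\,\big|\,y,i\big),$$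 the first term being the entropy of the prior joint distribution of the items other than $d_j$, the second the entropy of their joint distribution under the posterior $P(\cdot\mid y,i)$. **Theorem.** For all constants $c>0$ and $a>0$ there is a constant $C>0$ such that the following holds for all $k,m\ge1$ with $m\ge c\log k$. If $A_0,\dots,A_{k-1}$ are independent random $\ell\times\ell$ matrices, each distributed according to the Haar probability measure of the unitary group (respectively, each according to that of the orthogonal group), then with probability at least $1-(k\,2^m)^{-a}$ we have $$I_{j,i,y}\le C\,k\log(m+\log k)$$ for every chosen item $j$, every encoding $i$ and every outcome $y$. -/

import Mathlib

open MeasureTheory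

noncomputable section

/-! ### Haar-random orthonormal matrices

`Matrix.unitaryGroup (Fin l) 𝕜` is the unitary group for `𝕜 = ℂ`, the orthogonal group for `𝕜 = ℝ`. -/

instance instCompactSpaceUnitaryGroup (𝕜 : Type*) [RCLike 𝕜] (l : ℕ) :
    CompactSpace (Matrix.unitaryGroup (Fin l) 𝕜) := by
  apply isCompact_iff_compactSpace.mp
  have hK : IsCompact (Set.pi Set.univ fun _ : Fin l => Set.pi Set.univ fun _ : Fin l =>
      Metric.closedBall (0 : 𝕜) 1) :=
    isCompact_univ_pi fun _ => isCompact_univ_pi fun _ => isCompact_closedBall 0 1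
  refine IsCompact.of_isClosed_subset (X := Matrix (Fin l) (Fin l) 𝕜) hK isClosed_unitary ?_
  intro U hU a _ b _
  simpa using entry_norm_bound_of_unitary hU a b

instance instMeasurableSpaceUnitaryGroup (𝕜 : Type*) [RCLike 𝕜] (l : ℕ) :
    MeasurableSpace (Matrix.unitaryGroup (Fin l) 𝕜) := borel _

instance instBorelSpaceUnitaryGroup (𝕜 : Type*) [RCLike 𝕜] (l : ℕ) :
    BorelSpace (Matrix.unitaryGroup (Fin l) 𝕜) := ⟨rfl⟩

/-- The Haar probability measure on the group of `l × l` unitary (orthogonal) matrices. -/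
def haarUnitary (𝕜 : Type*) [RCLike 𝕜] (l : ℕ) : Measure (Matrix.unitaryGroup (Fin l) 𝕜) :=
  Measure.haarMeasure ⊤

/-- The law of `k` independent Haar-random `2^m × 2^m` matrices. -/
def randomMatrices (𝕜 : Type*) [RCLike 𝕜] (k m : ℕ) :
    Measure (Fin k → Matrix.unitaryGroup (Fin (2 ^ m)) 𝕜) :=
  Measure.pi fun _ => haarUnitary 𝕜 (2 ^ m)

/-! ### The protocol -/

/-- A database: `k` items of `m` bits each, an item being a number below `2^m`. -/
abbrev Database (k m : ℕ) : Type := Fin k → Fin (2 ^ m)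

/-- The tensor product `A 0 ⊗ A 1 ⊗ ⋯ ⊗ A (k-1)` of square matrices, acting on the joint space. -/
def tensorProd {𝕜 : Type*} [RCLike 𝕜] {k m : ℕ}
    (A : Fin k → Matrix (Fin (2 ^ m)) (Fin (2 ^ m)) 𝕜) :
    Matrix (Database k m) (Database k m) 𝕜 :=
  Matrix.of fun x y => ∏ p, A p (x p) (y p)

/-- `C_i = A_i ⊗ A_{i+1} ⊗ ⋯ ⊗ A_{k-1} ⊗ A_0 ⊗ ⋯ ⊗ A_{i-1}` (indices modulo `k`). -/
def cyclicTensor {𝕜 : Type*} [RCLike 𝕜] {k m : ℕ} [NeZero k]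
    (A : Fin k → Matrix.unitaryGroup (Fin (2 ^ m)) 𝕜) (i : Fin k) :
    Matrix (Database k m) (Database k m) 𝕜 :=
  tensorProd fun p => (A (i + p) : Matrix (Fin (2 ^ m)) (Fin (2 ^ m)) 𝕜)

/-- The permutation matrix `P_i` sending `d_0 d_1 … d_{k-1}` to
`d_i d_{i+1} … d_{k-1} d_0 … d_{i-1}`. -/
def reorder (𝕜 : Type*) [RCLike 𝕜] {k : ℕ} (m : ℕ) [NeZero k] (i : Fin k) :
    Matrix (Database k m) (Database k m) 𝕜 :=
  Matrix.of fun c d => if c = fun p => d (i + p) then 1 else 0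

/-- The encoding matrix `E_i = C_i P_i`; database `d` is sent as column `d` of `E_i`. -/
def encoding {𝕜 : Type*} [RCLike 𝕜] {k m : ℕ} [NeZero k]
    (A : Fin k → Matrix.unitaryGroup (Fin (2 ^ m)) 𝕜) (i : Fin k) :
    Matrix (Database k m) (Database k m) 𝕜 :=
  cyclicTensor A i * reorder 𝕜 m i

/-- The honest measurement for item `j`: `M_j = A_j† ⊗ A_j† ⊗ ⋯ ⊗ A_j†`. -/
def honestMeasurement {𝕜 : Type*} [RCLike 𝕜] {k m : ℕ}
    (A : Fin k → Matrix.unitaryGroup (Fin (2 ^ m)) 𝕜) (j : Fin k) :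
    Matrix (Database k m) (Database k m) 𝕜 :=
  tensorProd fun _ => (A j : Matrix (Fin (2 ^ m)) (Fin (2 ^ m)) 𝕜).conjTranspose

/-- `P(y | d, i) = |(M E_i)_{y,d}|²`: the probability that measuring with `M` gives the outcome `y`
when the database is `d` and the vendor uses the encoding `E_i`. -/
def outcomeProb {𝕜 : Type*} [RCLike 𝕜] {k m : ℕ} [NeZero k]
    (A : Fin k → Matrix.unitaryGroup (Fin (2 ^ m)) 𝕜)
    (M : Matrix (Database k m) (Database k m) 𝕜) (i : Fin k) (y d : Database k m) : ℝ :=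
  ‖(M * encoding A i) y d‖ ^ 2

/-- The uniform prior on databases. -/
def prior (k m : ℕ) (_d : Database k m) : ℝ := 1 / (Fintype.card (Database k m) : ℝ)

/-- The posterior `P(d | y, i)` on databases, given the outcome `y` and the announced encoding `i`,
by Bayes' theorem. -/
def posterior {𝕜 : Type*} [RCLike 𝕜] {k m : ℕ} [NeZero k]
    (A : Fin k → Matrix.unitaryGroup (Fin (2 ^ m)) 𝕜)
    (M : Matrix (Database k m) (Database k m) 𝕜) (i : Fin k) (y d : Database k m) : ℝ :=
  outcomeProb A M i y d * prior k m d / ∑ d', outcomeProb A M i y d' * prior k m d'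

/-! ### Information -/

/-- Shannon entropy, in bits, of a distribution on a finite type (with `0 log 0 = 0`). -/
def entropyBits {ι : Type*} [Fintype ι] (p : ι → ℝ) : ℝ :=
  -∑ x, p x * Real.logb 2 (p x)

/-- The marginal on the items other than item `j` of a distribution on databases. -/
def marginalOthers {k m : ℕ} (j : Fin k) (p : Database k m → ℝ)
    (w : {s : Fin k // s ≠ j} → Fin (2 ^ m)) : ℝ :=
  ∑ d : Database k m, if (∀ s : {s : Fin k // s ≠ j}, d s = w s) then p d else 0

/-- The number of bits that an honest user who chose item `j`, measured with `M_j`, observed the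
outcome `y` and was then told the encoding `i` has learned about the items other than item `j`:
the reduction of the entropy of the joint distribution of those items. -/
def infoAboutOthers {𝕜 : Type*} [RCLike 𝕜] {k m : ℕ} [NeZero k]
    (A : Fin k → Matrix.unitaryGroup (Fin (2 ^ m)) 𝕜) (j i : Fin k) (y : Database k m) : ℝ :=
  entropyBits (marginalOthers j (prior k m)) -
    entropyBits (marginalOthers j (posterior A (honestMeasurement A j) i y))

end

/-! The outcome probability of an honest measurement factorizes over items: item `s` contributes the
squared modulus of an entry of `A_j† A_s`. Rows of unitary matrices have norm 1, so the posterior is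
a product distribution, and so is its marginal on the items other than `j`. If all entries of `A_j†
A_s` with `s ≠ j` have squared modulus at most `K / 2^m`, every atom of that marginal is at most `(K
/ 2^m)^(k-1)`. Its entropy is then at least `(k-1)(m - log K)`, a loss of at most `(k-1) log K` bits
(`infoAboutOthers_le`).

For `s ≠ j` the matrix `A_j† A_s` is Haar-distributed, and its scaled entries have an exponential
tail (`haarUnitary_entry_tail`). A union bound over all entries allows `K` of order `m + log k`. -/

/-! ### Entropy bounds and product structure of the posterior -/

theorem entropyBits_le_of_forall_ge {ι : Type*} [Fintype ι] {p : ι → ℝ} (h0 : ∀ x, 0 ≤ p x)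
    (h1 : ∑ x, p x = 1) {B : ℝ} (hB : 0 < B) (h : ∀ x, B ≤ p x) :
    entropyBits p ≤ -Real.logb 2 B := by
  have : ∑ x, p x * Real.logb 2 B ≤ ∑ x, p x * Real.logb 2 (p x) :=
    Finset.sum_le_sum fun x _ =>
      mul_le_mul_of_nonneg_left (Real.logb_le_logb_of_le (by norm_num) hB (h x)) (h0 x)
  rw [← Finset.sum_mul, h1, one_mul] at this
  exact neg_le_neg this

/-- Shannon entropy dominates min-entropy. -/
theorem le_entropyBits_of_forall_le {ι : Type*} [Fintype ι] {p : ι → ℝ} (h0 : ∀ x, 0 ≤ p x)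
    (h1 : ∑ x, p x = 1) {B : ℝ} (h : ∀ x, p x ≤ B) :
    -Real.logb 2 B ≤ entropyBits p := by
  have : ∑ x, p x * Real.logb 2 (p x) ≤ ∑ x, p x * Real.logb 2 B := by
    refine Finset.sum_le_sum fun x _ => ?_
    rcases (h0 x).eq_or_lt with hx | hx
    · simp [← hx]
    · exact mul_le_mul_of_nonneg_left (Real.logb_le_logb_of_le (by norm_num) hx (h x)) hx.le
  rw [← Finset.sum_mul, h1, one_mul] at this
  exact neg_le_neg this

/-- The marginal of a product distribution is the product of the remaining factors. -/
theorem marginalOthers_prod {k m : ℕ} (j : Fin k) (r : Fin k → Fin (2 ^ m) → ℝ)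
    (hr : ∑ x, r j x = 1) (w : {s : Fin k // s ≠ j} → Fin (2 ^ m)) :
    marginalOthers j (fun d => ∏ s, r s (d s)) w = ∏ s : {s : Fin k // s ≠ j}, r s (w s) := by
  unfold marginalOthers
  rw [← (Equiv.funSplitAt j (Fin (2 ^ m))).symm.sum_comp, Fintype.sum_prod_type]
  have key : ∀ x v, (if ∀ s : {s : Fin k // s ≠ j},
        (Equiv.funSplitAt j (Fin (2 ^ m))).symm (x, v) s = w s
      then ∏ s, r s ((Equiv.funSplitAt j (Fin (2 ^ m))).symm (x, v) s) else 0) =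
      if v = w then r j x * ∏ s : {s : Fin k // s ≠ j}, r s (w s) else 0 := by
    intro x v
    have hv : ∀ s : {s : Fin k // s ≠ j},
        (Equiv.funSplitAt j (Fin (2 ^ m))).symm (x, v) s = v s := fun s => by
      simp [Equiv.funSplitAt, Equiv.piSplitAt, s.2]
    simp only [hv, ← funext_iff]
    split_ifs with h
    · subst h
      rw [Fintype.prod_eq_mul_prod_subtype_ne _ j]
      simp only [hv]
      simp [Equiv.funSplitAt, Equiv.piSplitAt]
    · rfl
  simp_rw [key]
  simp [← Finset.sum_mul, hr]

theorem sum_marginalOthers {k m : ℕ} (j : Fin k) (p : Database k m → ℝ) :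
    ∑ w, marginalOthers j p w = ∑ d, p d := by
  unfold marginalOthers
  rw [Finset.sum_comm]
  refine Finset.sum_congr rfl fun d _ => ?_
  rw [Fintype.sum_eq_single (fun s => d s.1)]
  · simp
  · intro w hw
    rw [if_neg]
    exact fun h => hw (funext fun s => (h s).symm)

theorem sum_prod_eq_one {k m : ℕ} (r : Fin k → Fin (2 ^ m) → ℝ)
    (hr : ∀ s, ∑ x, r s x = 1) : ∑ d : Database k m, ∏ s, r s (d s) = 1 := by
  rw [← Fintype.prod_sum]
  simp [hr]

theorem sum_norm_sq_row_eq_one {𝕜 : Type*} [RCLike 𝕜] {l : ℕ}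
    (U : Matrix.unitaryGroup (Fin l) 𝕜) (x : Fin l) : ∑ y, ‖U.1 x y‖ ^ 2 = 1 := by
  have h := congrFun (congrFun (Matrix.mem_unitaryGroup_iff.1 U.2) x) x
  rw [Matrix.mul_apply] at h
  simp only [Matrix.star_apply, RCLike.star_def, RCLike.mul_conj, Matrix.one_apply_eq] at h
  exact_mod_cast h

theorem sum_norm_sq_col_eq_one {𝕜 : Type*} [RCLike 𝕜] {l : ℕ}
    (U : Matrix.unitaryGroup (Fin l) 𝕜) (y : Fin l) : ∑ x, ‖U.1 x y‖ ^ 2 = 1 := by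
  have h := congrFun (congrFun (Matrix.mem_unitaryGroup_iff'.1 U.2) y) y
  rw [Matrix.mul_apply] at h
  simp only [Matrix.star_apply, RCLike.star_def, RCLike.conj_mul, Matrix.one_apply_eq] at h
  exact_mod_cast h

theorem tensorProd_mul {𝕜 : Type*} [RCLike 𝕜] {k m : ℕ}
    (A B : Fin k → Matrix (Fin (2 ^ m)) (Fin (2 ^ m)) 𝕜) :
    tensorProd A * tensorProd B = tensorProd fun p => A p * B p := by
  ext x y
  simp only [tensorProd, Matrix.mul_apply, Matrix.of_apply, ← Finset.prod_mul_distrib]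
  rw [Fintype.prod_sum]

/-- The distribution of the outcome of an honest measurement factorizes over the items. -/
theorem outcomeProb_honestMeasurement {𝕜 : Type*} [RCLike 𝕜] {k m : ℕ} [NeZero k]
    (A : Fin k → Matrix.unitaryGroup (Fin (2 ^ m)) 𝕜) (j i : Fin k) (y d : Database k m) :
    outcomeProb A (honestMeasurement A j) i y d =
      ∏ s, ‖((A j)⁻¹ * A s).1 (y (s - i)) (d s)‖ ^ 2 := by
  unfold outcomeProb encoding honestMeasurement cyclicTensor
  rw [← Matrix.mul_assoc, tensorProd_mul, Matrix.mul_apply]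
  simp only [reorder, Matrix.of_apply, mul_ite, mul_one, mul_zero, Finset.sum_ite_eq',
    Finset.mem_univ, if_true]
  simp only [tensorProd, Matrix.of_apply, norm_prod, ← Finset.prod_pow]
  -- Tensor position `p` carries item `i + p`.
  refine Fintype.prod_equiv (Equiv.addLeft i) _ _ fun p => ?_
  simp only [Equiv.coe_addLeft, add_sub_cancel_left]
  rfl

/-- If all the entries of the products `A_j† A_s` with `s ≠ j` are small, the user learns little. -/
theorem infoAboutOthers_le {𝕜 : Type*} [RCLike 𝕜] {k m : ℕ} [NeZero k]
    (A : Fin k → Matrix.unitaryGroup (Fin (2 ^ m)) 𝕜) (j i : Fin k) (y : Database k m)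
    {K : ℝ} (hK : 0 < K)
    (h : ∀ s, s ≠ j → ∀ x z, ‖((A j)⁻¹ * A s).1 x z‖ ^ 2 ≤ K / 2 ^ m) :
    infoAboutOthers A j i y ≤ (k - 1 : ℕ) * Real.logb 2 K := by
  have hcard : Fintype.card {s : Fin k // s ≠ j} = k - 1 := by
    simp [Fintype.card_subtype_compl]
  have hpost : posterior A (honestMeasurement A j) i y =
      fun d => ∏ s, ‖((A j)⁻¹ * A s).1 (y (s - i)) (d s)‖ ^ 2 := by
    funext d
    unfold posterior prior
    rw [← Finset.sum_mul, mul_div_mul_right _ _ (by positivity)]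
    simp only [outcomeProb_honestMeasurement]
    -- The uniform prior has cancelled, and unit rows make the Bayes denominator equal to 1.
    rw [sum_prod_eq_one (fun s x => ‖((A j)⁻¹ * A s).1 (y (s - i)) x‖ ^ 2)
      fun s => sum_norm_sq_row_eq_one _ _, div_one]
  have hprior : prior k m = fun d => ∏ s : Fin k, (fun _ _ => 1 / (2 : ℝ) ^ m) s (d s) := by
    funext d
    simp [prior]
  have hm : ∑ x : Fin (2 ^ m), 1 / (2 : ℝ) ^ m = 1 := by simp
  have h1 : entropyBits (marginalOthers j (prior k m)) ≤
      -Real.logb 2 ((1 / (2 : ℝ) ^ m) ^ (k - 1)) := by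
    have hq : ∀ w, marginalOthers j (prior k m) w = (1 / (2 : ℝ) ^ m) ^ (k - 1) := by
      intro w
      rw [hprior, marginalOthers_prod j (fun _ _ => 1 / (2 : ℝ) ^ m) hm, Finset.prod_const, Finset.card_univ, hcard]
    refine entropyBits_le_of_forall_ge (fun w => ?_) ?_ (by positivity) fun w => (hq w).ge
    · rw [hq]; positivity
    · rw [sum_marginalOthers, hprior, sum_prod_eq_one _ fun _ => hm]
  have h2 : -Real.logb 2 ((K / (2 : ℝ) ^ m) ^ (k - 1)) ≤
      entropyBits (marginalOthers j (posterior A (honestMeasurement A j) i y)) := by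
    have hq := fun w => marginalOthers_prod j
      (fun s x => ‖((A j)⁻¹ * A s).1 (y (s - i)) x‖ ^ 2) (sum_norm_sq_row_eq_one _ _) w
    rw [hpost]
    refine le_entropyBits_of_forall_le (fun w => ?_) ?_ fun w => ?_
    · rw [hq]; positivity
    · rw [sum_marginalOthers]
      exact sum_prod_eq_one (fun s x => ‖((A j)⁻¹ * A s).1 (y (s - i)) x‖ ^ 2)
        fun s => sum_norm_sq_row_eq_one _ _
    · rw [hq, ← hcard, ← Finset.card_univ, ← Finset.prod_const]
      exact Finset.prod_le_prod (fun _ _ => by positivity) fun s _ => h s s.2 _ _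
  unfold infoAboutOthers
  rw [Real.logb_pow, Real.logb_div one_ne_zero (by positivity), Real.logb_one] at h1
  rw [Real.logb_pow, Real.logb_div hK.ne' (by positivity)] at h2
  linarith

/-! ### Hoeffding bounds by counting sign vectors -/

/-- The sign `±1` encoded by a Boolean. -/
def boolSign (b : Bool) : ℝ := if b then 1 else -1

/-- The exponential moment factorizes over coordinates, and each factor is `2 cosh (v i) ≤ 2 exp (v
i ^ 2 / 2)`. -/
theorem sum_exp_boolSign_le {l : ℕ} (v : Fin l → ℝ) :
    ∑ e : Fin l → Bool, Real.exp (∑ i, boolSign (e i) * v i) ≤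
      2 ^ l * Real.exp ((∑ i, v i ^ 2) / 2) := by
  simp_rw [Real.exp_sum]
  rw [← Fintype.prod_sum (fun i b => Real.exp (boolSign b * v i)), Finset.sum_div, Real.exp_sum]
  have : ∏ _i : Fin l, (2 : ℝ) = 2 ^ l := by simp
  rw [← this, ← Finset.prod_mul_distrib]
  refine Finset.prod_le_prod (fun i _ => by positivity) fun i _ => ?_
  have h := Real.cosh_le_exp_half_sq (v i)
  rw [Real.cosh_eq] at h
  simp only [Fintype.univ_bool, boolSign, Finset.sum_pair, ne_eq, Bool.true_eq_false,
    not_false_eq_true, if_true, Bool.false_eq_true, if_false, one_mul, neg_mul]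
  linarith

/-- Chernoff's method, with the optimal exponential parameter `t` itself. -/
theorem card_lt_sum_boolSign_le {l : ℕ} (v : Fin l → ℝ) (hv : ∑ i, v i ^ 2 ≤ 1) {t : ℝ}
    (ht : 0 ≤ t) :
    (Finset.card {e : Fin l → Bool | t < ∑ i, boolSign (e i) * v i} : ℝ) ≤
      2 ^ l * Real.exp (-(t ^ 2 / 2)) := by
  have h := sum_exp_boolSign_le fun i => t * v i
  have h1 : (Finset.card {e : Fin l → Bool | t < ∑ i, boolSign (e i) * v i} : ℝ) *
      Real.exp (t ^ 2) ≤
      ∑ e : Fin l → Bool, Real.exp (∑ i, boolSign (e i) * (t * v i)) := by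
    rw [← nsmul_eq_mul, ← Finset.sum_const]
    refine (Finset.sum_le_sum fun e he => ?_).trans
      (Finset.sum_le_univ_sum_of_nonneg fun _ => Real.exp_nonneg _)
    rw [Real.exp_le_exp]
    have := (Finset.mem_filter.1 he).2
    simp_rw [mul_left_comm _ t]
    rw [← Finset.mul_sum]
    nlinarith
  have h2 : Real.exp ((∑ i, (t * v i) ^ 2) / 2) ≤ Real.exp (t ^ 2 / 2) := by
    rw [Real.exp_le_exp]
    simp_rw [mul_pow]
    rw [← Finset.mul_sum]
    nlinarith [sq_nonneg t]
  have h3 : Real.exp (t ^ 2 / 2) = Real.exp (-(t ^ 2 / 2)) * Real.exp (t ^ 2) := by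
    rw [← Real.exp_add]; ring_nf
  have h4 := (h1.trans h).trans (mul_le_mul_of_nonneg_left h2 (by positivity))
  rw [h3, ← mul_assoc] at h4
  exact le_of_mul_le_mul_right h4 (Real.exp_pos _)

theorem card_lt_sq_sum_boolSign_le {l : ℕ} (v : Fin l → ℝ) (hv : ∑ i, v i ^ 2 ≤ 1) {t : ℝ}
    (ht : 0 ≤ t) :
    (Finset.card {e : Fin l → Bool | t < (∑ i, boolSign (e i) * v i) ^ 2} : ℝ) ≤
      2 * (2 ^ l * Real.exp (-(t / 2))) := by
  have h1 := card_lt_sum_boolSign_le v hv (Real.sqrt_nonneg t)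
  have h2 := card_lt_sum_boolSign_le (-v) (by simpa using hv) (Real.sqrt_nonneg t)
  rw [Real.sq_sqrt ht] at h1 h2
  have : (Finset.univ.filter fun e : Fin l → Bool => t < (∑ i, boolSign (e i) * v i) ^ 2) ⊆
      (Finset.univ.filter fun e : Fin l → Bool => √t < ∑ i, boolSign (e i) * v i) ∪
      (Finset.univ.filter fun e : Fin l → Bool => √t < ∑ i, boolSign (e i) * (-v) i) := by
    intro e he
    have h := (Finset.mem_filter.1 he).2
    have h := Real.sqrt_lt_sqrt ht h
    rw [Real.sqrt_sq_eq_abs, lt_abs] at h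
    simpa [Finset.sum_neg_distrib] using h
  have h3 : (Finset.card _ : ℝ) ≤ _ :=
    Nat.cast_le.2 ((Finset.card_le_card this).trans (Finset.card_union_le _ _))
  push_cast at h3
  linarith

/-- Hoeffding's inequality for a random signed sum of real or complex numbers. -/
theorem card_lt_norm_sq_sum_boolSign_le {𝕜 : Type*} [RCLike 𝕜] {l : ℕ} (v : Fin l → 𝕜)
    (hv : ∑ i, ‖v i‖ ^ 2 ≤ 1) {t : ℝ} (ht : 0 ≤ t) :
    (Finset.card {e : Fin l → Bool | t < ‖∑ i, (boolSign (e i) : 𝕜) * v i‖ ^ 2} : ℝ) ≤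
      4 * (2 ^ l * Real.exp (-(t / 4))) := by
  have hn : ∀ z : 𝕜, ‖z‖ ^ 2 = RCLike.re z ^ 2 + RCLike.im z ^ 2 := fun z => by
    rw [RCLike.norm_sq_eq_def]; ring
  have h1 := card_lt_sq_sum_boolSign_le (fun i => RCLike.re (v i))
    ((Finset.sum_le_sum fun i _ => by rw [hn]; nlinarith [sq_nonneg (RCLike.im (v i))]).trans hv)
    (div_nonneg ht zero_le_two)
  have h2 := card_lt_sq_sum_boolSign_le (fun i => RCLike.im (v i))
    ((Finset.sum_le_sum fun i _ => by rw [hn]; nlinarith [sq_nonneg (RCLike.re (v i))]).trans hv)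
    (div_nonneg ht zero_le_two)
  -- Either the real or the imaginary part has square above `t / 2`, which costs a factor 2 in the
  -- exponent and one in front.
  have : (Finset.univ.filter fun e : Fin l → Bool =>
        t < ‖∑ i, (boolSign (e i) : 𝕜) * v i‖ ^ 2) ⊆
      (Finset.univ.filter fun e : Fin l → Bool =>
        t / 2 < (∑ i, boolSign (e i) * RCLike.re (v i)) ^ 2) ∪
      (Finset.univ.filter fun e : Fin l → Bool =>
        t / 2 < (∑ i, boolSign (e i) * RCLike.im (v i)) ^ 2) := by
    intro e he
    have h := (Finset.mem_filter.1 he).2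
    rw [hn] at h
    simp only [map_sum, RCLike.re_ofReal_mul, RCLike.im_ofReal_mul] at h
    simp only [Finset.mem_union, Finset.mem_filter, Finset.mem_univ, true_and]
    by_contra! hc
    linarith
  have h3 : (Finset.card _ : ℝ) ≤ _ :=
    Nat.cast_le.2 ((Finset.card_le_card this).trans (Finset.card_union_le _ _))
  push_cast at h3
  have h4 : t / 2 / 2 = t / 4 := by ring
  rw [h4] at h1 h2
  linarith

/-! ### Tail of a Haar-random entry -/

instance instSecondCountableTopologyUnitaryGroup (𝕜 : Type*) [RCLike 𝕜] (l : ℕ) :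
    SecondCountableTopology (Matrix.unitaryGroup (Fin l) 𝕜) :=
  haveI : SecondCountableTopology (Matrix (Fin l) (Fin l) 𝕜) :=
    inferInstanceAs (SecondCountableTopology (Fin l → Fin l → 𝕜))
  TopologicalSpace.Subtype.secondCountableTopology _

instance instIsProbabilityMeasureHaarUnitary (𝕜 : Type*) [RCLike 𝕜] (l : ℕ) :
    IsProbabilityMeasure (haarUnitary 𝕜 l) :=
  ⟨Measure.haarMeasure_self
    (K₀ := (⊤ : TopologicalSpace.PositiveCompacts (Matrix.unitaryGroup (Fin l) 𝕜)))⟩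

instance instIsMulLeftInvariantHaarUnitary (𝕜 : Type*) [RCLike 𝕜] (l : ℕ) :
    (haarUnitary 𝕜 l).IsMulLeftInvariant :=
  inferInstanceAs (Measure.haarMeasure _).IsMulLeftInvariant

theorem measurable_unitaryGroup_entry {𝕜 : Type*} [RCLike 𝕜] {l : ℕ} (x y : Fin l) :
    Measurable fun U : Matrix.unitaryGroup (Fin l) 𝕜 => U.1 x y := by
  have h : Continuous fun U : Matrix.unitaryGroup (Fin l) 𝕜 =>
    (U : Matrix (Fin l) (Fin l) 𝕜) := continuous_subtype_val
  exact (h.matrix_elem x y).measurable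

/-- Every unit vector is a row of some unitary matrix. -/
theorem exists_unitaryGroup_row_eq {𝕜 : Type*} [RCLike 𝕜] {l : ℕ} (x : Fin l) (w : Fin l → 𝕜)
    (hw : ∑ i, ‖w i‖ ^ 2 = 1) : ∃ V : Matrix.unitaryGroup (Fin l) 𝕜, ∀ i, V.1 x i = w i := by
  have hn : ‖(WithLp.toLp 2 w : EuclideanSpace 𝕜 (Fin l))‖ = 1 := by
    rw [EuclideanSpace.norm_eq]; simp [hw]
  obtain ⟨b, hb⟩ := Orthonormal.exists_orthonormalBasis_extension_of_card_eq (𝕜 := 𝕜)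
    (E := EuclideanSpace 𝕜 (Fin l)) (ι := Fin l) (by simp)
    (v := fun _ => WithLp.toLp 2 w) (s := {x})
    ⟨fun _ => hn, fun i j h => (h (Subsingleton.elim i j)).elim⟩
  refine ⟨⟨((EuclideanSpace.basisFun (Fin l) 𝕜).toBasis.toMatrix b).transpose, ?_⟩, fun i => ?_⟩
  · exact Matrix.transpose_mem_unitaryGroup_iff.2
      ((EuclideanSpace.basisFun (Fin l) 𝕜).toMatrix_orthonormalBasis_mem_unitary b)
  · simp [Module.Basis.toMatrix_apply, hb x rfl]

/-- Left multiplication by a unitary `V` whose row `x` is `±1/√l` preserves Haar measure and turns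
entry `(x, y)` into a signed sum of column `y` over `√l`. The tail is thus the same for every sign
pattern. Averaging over patterns and applying Hoeffding for each fixed `U`, whose column has norm 1,
gives the bound. -/
theorem haarUnitary_entry_tail {𝕜 : Type*} [RCLike 𝕜] {l : ℕ} (x y : Fin l) {t : ℝ}
    (ht : 0 ≤ t) :
    (haarUnitary 𝕜 l).real {U | t / l < ‖U.1 x y‖ ^ 2} ≤ 4 * Real.exp (-(t / 4)) := by
  have hl : (0 : ℝ) < l := by exact_mod_cast x.pos
  set S : (Fin l → Bool) → Set (Matrix.unitaryGroup (Fin l) 𝕜) := fun e =>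
    {U | t < ‖∑ i, (boolSign (e i) : 𝕜) * U.1 i y‖ ^ 2} with hS
  have hSm : ∀ e, MeasurableSet (S e) := fun e => by
    refine measurableSet_lt measurable_const ?_
    exact ((Finset.measurable_sum _ fun i _ =>
      (measurable_unitaryGroup_entry i y).const_mul _).norm).pow_const 2
  have hsq : ∀ b, ‖(boolSign b : 𝕜)‖ ^ 2 = 1 := fun b => by cases b <;> simp [boolSign]
  have heq : ∀ e, (haarUnitary 𝕜 l).real {U | t / l < ‖U.1 x y‖ ^ 2} =
      (haarUnitary 𝕜 l).real (S e) := fun e => by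
    obtain ⟨V, hV⟩ := exists_unitaryGroup_row_eq (𝕜 := 𝕜) x
      (fun i => (boolSign (e i) : 𝕜) * ((√l)⁻¹ : ℝ)) (by
        have : ∀ i, ‖(boolSign (e i) : 𝕜) * ((√l)⁻¹ : ℝ)‖ ^ 2 = (l : ℝ)⁻¹ := fun i => by
          rw [norm_mul, mul_pow, hsq, RCLike.norm_ofReal, sq_abs, inv_pow,
            Real.sq_sqrt hl.le, one_mul]
        rw [Finset.sum_congr rfl fun i _ => this i]
        simp [hl.ne'])
    rw [measureReal_def, ← measure_preimage_mul _ V, ← measureReal_def]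
    congr 1
    ext U
    have : (V * U).1 x y = ((√l)⁻¹ : ℝ) * ∑ i, (boolSign (e i) : 𝕜) * U.1 i y := by
      change (V.1 * U.1) x y = _
      rw [Matrix.mul_apply, Finset.mul_sum]
      exact Finset.sum_congr rfl fun i _ => by rw [hV]; ring
    simp only [Set.mem_preimage, Set.mem_ofPred_eq, this, hS]
    rw [norm_mul, mul_pow, RCLike.norm_ofReal, sq_abs, inv_pow, Real.sq_sqrt hl.le,
      ← div_eq_inv_mul, div_lt_div_iff_of_pos_right hl]
  have hint : ∀ e, Integrable ((S e).indicator fun _ => (1 : ℝ)) (haarUnitary 𝕜 l) := fun e =>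
    (integrable_const 1).indicator (hSm e)
  have hsum : ∑ e, (haarUnitary 𝕜 l).real (S e) ≤ 4 * (2 ^ l * Real.exp (-(t / 4))) := by
    have : ∀ e, (haarUnitary 𝕜 l).real (S e) =
        ∫ U, (S e).indicator (fun _ => (1 : ℝ)) U ∂haarUnitary 𝕜 l := fun e => by
      rw [integral_indicator_const _ (hSm e), smul_eq_mul, mul_one]
    simp_rw [this]
    rw [← integral_finsetSum _ fun e _ => hint e]
    -- For fixed `U` the sum of indicators counts the sign patterns with a large signed sum.
    refine (integral_mono (integrable_finsetSum _ fun e _ => hint e)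
      (integrable_const (4 * (2 ^ l * Real.exp (-(t / 4))))) fun U => ?_).trans (by simp)
    refine le_trans (le_of_eq ?_) (card_lt_norm_sq_sum_boolSign_le (fun i => U.1 i y)
      (sum_norm_sq_col_eq_one U y).le ht)
    simp [Set.indicator_apply, hS]
  simp_rw [← heq] at hsum
  rw [Finset.sum_const, nsmul_eq_mul, mul_left_comm] at hsum
  simp only [Finset.card_univ, Fintype.card_pi, Fintype.card_bool, Finset.prod_const,
    Fintype.card_fin, Nat.cast_pow, Nat.cast_ofNat] at hsum
  exact le_of_mul_le_mul_left hsum (by positivity)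

/-! ### Union bound and conclusion -/

instance instIsProbabilityMeasureRandomMatrices (𝕜 : Type*) [RCLike 𝕜] (k m : ℕ) :
    IsProbabilityMeasure (randomMatrices 𝕜 k m) :=
  inferInstanceAs (IsProbabilityMeasure (Measure.pi _))

/-- For `s ≠ j` the product `A_j† A_s` is Haar-distributed. -/
theorem measurePreserving_inv_mul_randomMatrices {𝕜 : Type*} [RCLike 𝕜] {k m : ℕ} {s j : Fin k}
    (h : j ≠ s) : MeasurePreserving (fun A => (A j)⁻¹ * A s) (randomMatrices 𝕜 k m)
      (haarUnitary 𝕜 (2 ^ m)) := by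
  have hind : ProbabilityTheory.IndepFun (fun A => A j) (fun A => A s) (randomMatrices 𝕜 k m) :=
    (ProbabilityTheory.iIndepFun_pi (X := fun _ => id) fun _ => aemeasurable_id).indepFun h
  rw [ProbabilityTheory.indepFun_iff_map_prod_eq_prod_map_map (measurable_pi_apply j).aemeasurable
    (measurable_pi_apply s).aemeasurable] at hind
  have hev : ∀ i, (randomMatrices 𝕜 k m).map (fun A => A i) = haarUnitary 𝕜 (2 ^ m) := fun i =>
    (measurePreserving_eval (fun _ : Fin k => haarUnitary 𝕜 (2 ^ m)) i).map_eq
  rw [hev, hev] at hind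
  have hp : MeasurePreserving (fun A => (A j, A s)) (randomMatrices 𝕜 k m)
      ((haarUnitary 𝕜 (2 ^ m)).prod (haarUnitary 𝕜 (2 ^ m))) :=
    ⟨(measurable_pi_apply j).prodMk (measurable_pi_apply s), hind⟩
  -- By left invariance, `(U, V) ↦ (U, U⁻¹ V)` preserves the product of the Haar measures.
  exact measurePreserving_snd.comp ((measurePreserving_prod_inv_mul _ _).comp hp)

theorem randomMatrices_entry_tail {𝕜 : Type*} [RCLike 𝕜] {k m : ℕ} {t : ℝ} (ht : 0 ≤ t) :
    (randomMatrices 𝕜 k m).real {A | ∃ j s, s ≠ j ∧ ∃ x y,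
        t / 2 ^ m < ‖((A j)⁻¹ * A s).1 x y‖ ^ 2} ≤
      ((k : ℝ) * 2 ^ m) ^ 2 * (4 * Real.exp (-(t / 4))) := by
  set I := Fin k × Fin k × Fin (2 ^ m) × Fin (2 ^ m)
  set B : I → Set (Fin k → Matrix.unitaryGroup (Fin (2 ^ m)) 𝕜) := fun q =>
    {A | q.2.1 ≠ q.1 ∧ t / 2 ^ m < ‖((A q.1)⁻¹ * A q.2.1).1 q.2.2.1 q.2.2.2‖ ^ 2} with hB
  have hsub : {A : Fin k → Matrix.unitaryGroup (Fin (2 ^ m)) 𝕜 | ∃ j s, s ≠ j ∧ ∃ x y,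
      t / 2 ^ m < ‖((A j)⁻¹ * A s).1 x y‖ ^ 2} ⊆ ⋃ q, B q := by
    rintro A ⟨j, s, hs, x, y, h⟩
    exact Set.mem_iUnion.2 ⟨(j, s, x, y), hs, h⟩
  have hle : ∀ q, (randomMatrices 𝕜 k m).real (B q) ≤ 4 * Real.exp (-(t / 4)) := by
    rintro ⟨j, s, x, y⟩
    by_cases hs : s = j
    · simp only [hB, hs, ne_eq, not_true_eq_false, false_and, Set.ofPred_false, measureReal_empty]
      positivity
    · have hmp := measurePreserving_inv_mul_randomMatrices (𝕜 := 𝕜) (m := m) (Ne.symm hs)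
      have hm : MeasurableSet {U : Matrix.unitaryGroup (Fin (2 ^ m)) 𝕜 |
          t / (2 ^ m : ℕ) < ‖U.1 x y‖ ^ 2} :=
        measurableSet_lt measurable_const ((measurable_unitaryGroup_entry x y).norm.pow_const 2)
      refine le_trans (le_of_eq ?_) (haarUnitary_entry_tail (𝕜 := 𝕜) x y ht)
      rw [← hmp.measureReal_preimage hm.nullMeasurableSet]
      simp [hB, hs]
  refine (measureReal_mono hsub).trans ((measureReal_iUnion_fintype_le B).trans
    ((Finset.sum_le_sum fun q _ => hle q).trans (le_of_eq ?_)))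
  simp [I]
  ring

theorem mainTheorem4 {𝕜 : Type*} [RCLike 𝕜] (c : ℝ) (hc : 0 < c) (a : ℝ) (ha : 0 < a) :
    ∃ C : ℝ, 0 < C ∧
      ∀ (k m : ℕ) [NeZero k], 1 ≤ m → c * Real.logb 2 k ≤ m →
        1 - ((k : ℝ) * 2 ^ m) ^ (-a) ≤
          (randomMatrices 𝕜 k m).real
            {A | ∀ (j i : Fin k) (y : Database k m),
              infoAboutOthers A j i y ≤ C * (k * Real.logb 2 (m + Real.logb 2 k))} := by
  -- Chosen so that `exp (-(T * Λ / 4)) = N ^ (-(a + 4))`, where `Λ = log₂ N` and `N = k 2^m`.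
  set T : ℝ := 4 * (a + 4) * Real.log 2 with hT
  have hlog2 := Real.log_two_gt_d9
  have hT1 : 1 ≤ T := by nlinarith
  have hlogT : 0 ≤ Real.logb 2 T := Real.logb_nonneg (by norm_num) hT1
  refine ⟨Real.logb 2 T + 1, by positivity, fun k m _ hm _ => ?_⟩
  have hk : (1 : ℝ) ≤ k := by exact_mod_cast NeZero.one_le
  have hm' : (1 : ℝ) ≤ m := by exact_mod_cast hm
  have hlk : 0 ≤ Real.logb 2 k := Real.logb_nonneg (by norm_num) hk
  set Λ : ℝ := m + Real.logb 2 k with hΛ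
  have hΛ1 : 1 ≤ Λ := by linarith
  have hloglog : 0 ≤ Real.logb 2 Λ := Real.logb_nonneg (by norm_num) hΛ1
  set N : ℝ := (k : ℝ) * 2 ^ m with hN
  have hN2 : 2 ≤ N := by
    have : (2 : ℝ) ^ 1 ≤ 2 ^ m := pow_le_pow_right₀ (by norm_num) hm
    nlinarith
  have hN0 : 0 < N := by linarith
  have hlogN : Real.log N = Λ * Real.log 2 := by
    rw [hN, Real.log_mul (by positivity) (by positivity), Real.log_pow, hΛ, add_mul, Real.logb,
      div_mul_cancel₀ _ (by positivity)]
    ring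
  have hTΛ : 0 < T * Λ := by positivity
  have hbad := randomMatrices_entry_tail (𝕜 := 𝕜) (k := k) (m := m) hTΛ.le
  rw [← hN] at hbad
  have hexp : Real.exp (-(T * Λ / 4)) = N ^ (-a) * (N ^ 4)⁻¹ := by
    rw [← Real.rpow_natCast, ← Real.rpow_neg hN0.le, ← Real.rpow_add hN0,
      Real.rpow_def_of_pos hN0, hlogN, hT]
    congr 1
    push_cast
    ring
  have hprob : N ^ 2 * (4 * Real.exp (-(T * Λ / 4))) ≤ N ^ (-a) := by
    rw [hexp]
    -- The spare `N ^ (-4)` absorbs the `N ^ 2` terms of the union bound and, as `N ≥ 2`, the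
    -- constant 4.
    have h4 : N ^ 2 * (4 * (N ^ 4)⁻¹) ≤ 1 := by
      rw [← div_eq_mul_inv, ← mul_div_assoc, div_le_one (by positivity)]
      have h4 : 4 ≤ N ^ 2 := by nlinarith
      nlinarith [sq_nonneg N]
    have := mul_le_mul_of_nonneg_left h4 (Real.rpow_nonneg hN0.le (-a))
    linarith
  set G : Set (Fin k → Matrix.unitaryGroup (Fin (2 ^ m)) 𝕜) := {A | ∀ (j i : Fin k)
    (y : Database k m), infoAboutOthers A j i y ≤ (Real.logb 2 T + 1) * (k * Real.logb 2 Λ)}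
  have hG : Gᶜ ⊆ {A | ∃ j s, s ≠ j ∧ ∃ x y,
      T * Λ / 2 ^ m < ‖((A j)⁻¹ * A s).1 x y‖ ^ 2} := by
    intro A hA
    by_contra hcon
    simp only [Set.mem_ofPred_eq, not_exists, not_and, not_lt] at hcon
    refine hA fun j i y => (infoAboutOthers_le A j i y hTΛ (hcon j)).trans ?_
    rw [Real.logb_mul (by positivity) (by positivity)]
    -- For `k = 1`, `log Λ` may vanish, but there are no other items. For `k ≥ 2`, `Λ ≥ 2`, so `log
    -- Λ ≥ 1` absorbs `log T`.
    rcases eq_or_ne k 1 with rfl | hk1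
    · simp only [le_refl, Nat.sub_eq_zero_of_le, Nat.cast_zero, zero_mul]
      positivity
    · have hk2 : (2 : ℝ) ≤ k := by
        have := NeZero.ne k
        exact_mod_cast (by omega : 2 ≤ k)
      have h1 : 1 ≤ Real.logb 2 k := by
        rw [Real.le_logb_iff_rpow_le (by norm_num) (by positivity)]
        simpa using hk2
      have h2 : 1 ≤ Real.logb 2 Λ := by
        rw [Real.le_logb_iff_rpow_le (by norm_num) (by positivity), Real.rpow_one]
        linarith
      have h3 : ((k - 1 : ℕ) : ℝ) ≤ k := by exact_mod_cast Nat.sub_le k 1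
      calc ((k - 1 : ℕ) : ℝ) * (Real.logb 2 T + Real.logb 2 Λ)
          ≤ k * (Real.logb 2 T * Real.logb 2 Λ + Real.logb 2 Λ) := by
            gcongr
            exact le_mul_of_one_le_right hlogT h2
        _ = _ := by ring
  have htot : (1 : ℝ) ≤ (randomMatrices 𝕜 k m).real G + (randomMatrices 𝕜 k m).real Gᶜ := by
    have := measureReal_union_le (μ := randomMatrices 𝕜 k m) G Gᶜ
    rwa [Set.union_compl_self, probReal_univ] at this
  have := (measureReal_mono (μ := randomMatrices 𝕜 k m) hG).trans (hbad.trans hprob)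
  linarith
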